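/- **Setting.** Fix a first-order language $\mathcal L$ and an interpretation of it over a set $V$ of values (the theory $T$; $\models_T$ is truth in this interpretation). A *reactive program game structure* $\mathcal G=(T,\mathbb I,\mathbb X,L,\mathit{Inv},\delta)$ consists of disjoint finite sets $\mathbb I$ (inputs) and $\mathbb X$ (program variables), a finite set $L$ of locations, invariants $\mathit{Inv}(l)\in \mathrm{FOL}(\mathbb X)$, and a finite set $\delta$ of transitions $(l,g,u,l')$ with $g$ quantifier-free over $\mathbb X\cup\mathbb I$ and $u$ mapping $\mathbb X$ to terms over $\mathbb X\cup\mathbb I$, such that for each $l$: (1) the guards of the transitions leaving $l$ cover all assignments and distinct guards are disjoint; (2) $l,g,u$ determine $l'$; (3) for each $\mathbf x\models_T \mathit{Inv}(l)$ there are an input $\mathbf i$ and $(l,g,u,l')\in\delta$ with $\mathbf x\uplus\mathbf i\models_T g$ and $\mathbf x'\models_T \mathit{Inv}(l')$, where $\mathbf x'(x)$ is the value of $u(x)$ under $\mathbf x\uplus\mathbf i$. The game $[\![\mathcal G]\!]$ has as states the pairs $(l,\mathbf x)$ with $\mathbf x\models_T \mathit{Inv}(l)$; from $(l,\mathbf x)$,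 player Env picks an input assignment $\mathbf i$, then Sys picks an update $u$, and the game moves to $(l',\mathbf x')$ whenever $(l,g,u,l')\in\delta$, $\mathbf x\uplus\mathbf i\models_T g$, $\mathbf x'$ is as above and $\mathbf x'\models_T \mathit{Inv}(l')$; moves without a successor are not enabled. Strategies map state histories (for Sys, together with Env's current move) to enabled moves. Assume that $\mathcal G$ is *input-enabled*: in every state every input assignment is enabled. $\mathit{Attr}_{[\![\mathcal G]\!],p}(R)$ is the set of states from which player $p$ has a strategy all of whose plays visit $R$. The symbolic domain $\mathcal D$ is the set of maps $d:L\to \mathrm{FOL}(\mathbb X)$; $[\![d]\!]$ is the set of states $(l,\mathbf x)$ with $\mathbf x\models_T d(l)$; Boolean operations are taken locationwise. Put $$\mathit{CPre}_{\mathcal G,Env}(d)(l)=\mathit{Inv}(l)\wedge\exists\mathbb I.\bigwedge_{(l,g,u,l')\in\delta}(g\wedge \mathit{Inv}(l')[u]\to d(l')[u]),$$ $$\mathit{CPre}_{\mathcal G,Sys}(d)(l)=\mathit{Inv}(l)\wedge\forall\mathbb I.\bigvee_{(l,g,u,l')\in\delta}(g\wedge \mathit{Inv}(l')[u]\wedge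 d(l')[u]).$$ An *acceleration lemma* is a triple $(\mathit{base},\mathit{step},\mathit{conc})$ of formulas over $\mathbb X$, $\mathbb X\cup\mathbb X'$, $\mathbb X$ such that every infinite sequence of assignments that starts in $\mathit{conc}$ and whose consecutive pairs satisfy $\mathit{step}$ contains an assignment satisfying $\mathit{base}$, and every $\mathit{step}$-successor of an assignment satisfying $\mathit{conc}\wedge\neg\mathit{base}$ satisfies $\mathit{conc}$. $\mathsf{LoopGame}(\mathcal G,l,l_{End})$ is obtained from $\mathcal G$ by adding a fresh location $l_{End}$ with invariant $\mathit{Inv}(l)$ and the self-loop $(l_{End},\top,\mathrm{id},l_{End})$, and redirecting to $l_{End}$ all transitions with target $l$. **Procedures.** The heuristics, i.e. whether and where to accelerate and when $\mathsf{IterA}$ stops, are arbitrary. - $\mathsf{AccA}(\mathcal G,p,l,d)$: pick a fresh triple $(b,st,c)$ of uninterpreted predicate symbols and fresh constants $E=\{e_x\mid x\in\mathbb X\}$; let $(\Psi_{Rec},a)$ be the result of $\mathsf{IterA}(\mathsf{LoopGame}(\mathcal G,l,l_{End}),p,\top,d\cup\{l_{End}\mapsto st(E,\mathbb X)\})$ after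 the capture-avoiding substitution $[E\mapsto\mathbb X]$; return $(\Psi,\,c(\mathbb X)\wedge \mathit{Inv}(l))$ with $\Psi=(\forall\mathbb X.\,\mathit{Inv}(l)\wedge b(\mathbb X)\to d(l))\wedge(\forall\mathbb X.\,\mathit{Inv}(l)\wedge\neg d(l)\wedge c(\mathbb X)\to\Psi_{Rec}\wedge a(l))$. - $\mathsf{IterA}(\mathcal G,p,\Psi,d)$: either return $(\Psi,d)$; or choose a location $l$, let $(\Psi_{Rec},\varphi)=\mathsf{AccA}(\mathcal G,p,l,d)$ and return $\mathsf{IterA}(\mathcal G,p,\Psi\wedge\Psi_{Rec},d[l\mapsto d(l)\vee\varphi])$; or return $\mathsf{IterA}(\mathcal G,p,\Psi,d\vee \mathit{CPre}_{\mathcal G,p}(d))$. - $\mathsf{InstantiateLemmas}(\Psi,\varphi)$: search for a map $\lambda$ from the triples of lemma symbols to acceleration lemmas over $\mathbb X$ such that $\Psi[\lambda]$ is valid; return $\varphi[\lambda]$ if one is found, and $\bot$ otherwise. - $\textsc{AttractorAcc}(\mathcal G,p,d)$: set $a^0=\lambda l.\bot$ and $a^1=d$. For $n=1,2,\dots$: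 if $[\![a^n]\!]=[\![a^{n-1}]\!]$, return $a^n$; otherwise, optionally choose a location $l$, let $(\Psi,\varphi)=\mathsf{AccA}(\mathcal G,p,l,a^n)$ and replace $a^n(l)$ by $a^n(l)\vee\mathsf{InstantiateLemmas}(\Psi,\varphi)$; then set $a^{n+1}=a^n\vee \mathit{CPre}_{\mathcal G,p}(a^n)$. **Theorem.** Let $\mathcal G$ be an input-enabled reactive program game structure, $p\in\{Sys,Env\}$ and $d\in\mathcal D$. If $\textsc{AttractorAcc}(\mathcal G,p,d)$ terminates and returns $a$, then $[\![a]\!]=\mathit{Attr}_{[\![\mathcal G]\!],p}([\![d]\!])$. -/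

import Mathlib

open FirstOrder FirstOrder.Language

universe u v w z a b c

noncomputable section

/-! ### Two-player games of infinite duration -/

/-- The environment player and the system player. -/
inductive Player
  | env
  | sys

/-- A game structure with states `S`, environment moves `Me` and system moves `Ms`. -/
structure GameStructure (S : Type a) (Me : Type b) (Ms : Type c) where
  rel : S → Me → Ms → S → Prop
  total : ∀ s, ∃ me ms s', rel s me ms s'
  deterministic : ∀ s me ms s₁ s₂, rel s me ms s₁ → rel s me ms s₂ → s₁ = s₂

namespace GameStructure

variable {S : Type a} {Me : Type b} {Ms : Type c} (G : GameStructure S Me Ms)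

def enabledE (s : S) : Set Me := {me | ∃ ms s', G.rel s me ms s'}

def enabledS (s : S) (me : Me) : Set Ms := {ms | ∃ s', G.rel s me ms s'}

/-- Strategies. A nonempty sequence of states `s₀ ⋯ sₙ` is given as the list
`[s₀, …, sₙ₋₁]` of the earlier states together with the last state `sₙ`. -/
def Strategy : Player → Type (max a b c)
  | .env => ULift.{c} {σ : List S → S → Me // ∀ h s, σ h s ∈ G.enabledE s}
  | .sys => {σ : List S → S → Me → Ms // ∀ h s me, σ h s me ∈ G.enabledS s me}

/-- `π` is the outcome of the two strategies from the state `s`. -/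
def IsOutcome (s : S) (σe : G.Strategy .env) (σs : G.Strategy .sys) (π : ℕ → S) : Prop :=
  π 0 = s ∧ ∀ n,
    let h := (List.range n).map π
    let me := σe.down.1 h (π n)
    let ms := σs.1 h (π n) me
    G.rel (π n) me ms (π (n + 1))

/-- The plays from `s` that are consistent with a strategy of Player `p`. -/
def Plays : (p : Player) → S → G.Strategy p → Set (ℕ → S)
  | .env, s, σ => {π | ∃ τ : G.Strategy .sys, G.IsOutcome s σ τ π}
  | .sys, s, σ => {π | ∃ τ : G.Strategy .env, G.IsOutcome s τ σ π}

/-- The states from which Player `p` can enforce reaching `R`. -/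
def Attr (p : Player) (R : Set S) : Set S :=
  {s | ∃ σ : G.Strategy p, ∀ π ∈ G.Plays p s σ, ∃ n, π n ∈ R}

end GameStructure

/-! ### Reactive program game structures

The function and predicate symbols are those of a first-order language `ℒ`; the theory is the one
of a fixed interpretation of them over the set `V` of values, so that entailment modulo the theory
is truth in this `ℒ`-structure. The program variables are indexed by `Fin m`, the input variables
by `Fin r`; formulas over program and input variables use the disjoint sum `Fin m ⊕ Fin r`. -/

/-- A symbolic transition `(l, g, u, l')`. -/
structure Transition (ℒ : FirstOrder.Language.{u, v}) (m r : ℕ) (Loc : Type z) where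
  src : Loc
  guard : ℒ.Formula (Fin m ⊕ Fin r)
  update : Fin m → ℒ.Term (Fin m ⊕ Fin r)
  tgt : Loc

/-- The assignment `x'` with `x'(y)` the value of `u(y)` under `x ⊎ i`. -/
def nextAssignment {ℒ : FirstOrder.Language.{u, v}} {V : Type w} [ℒ.Structure V] {m r : ℕ}
    (u : Fin m → ℒ.Term (Fin m ⊕ Fin r)) (x : Fin m → V) (i : Fin r → V) : Fin m → V :=
  fun y => (u y).realize (Sum.elim x i)

/-- A reactive program game structure with set of locations `Loc`. -/
structure RPG (ℒ : FirstOrder.Language.{u, v}) (V : Type w) [ℒ.Structure V] (m r : ℕ) (Loc : Type z) where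
  finite_loc : Finite Loc
  Inv : Loc → ℒ.Formula (Fin m)
  δ : Set (Transition ℒ m r Loc)
  finite_δ : δ.Finite
  guard_qf : ∀ t ∈ δ, BoundedFormula.IsQF t.guard
  guards_cover : ∀ (l : Loc) (x : Fin m → V) (i : Fin r → V),
    ∃ t ∈ δ, t.src = l ∧ t.guard.Realize (Sum.elim x i)
  guards_disjoint : ∀ t₁ ∈ δ, ∀ t₂ ∈ δ, t₁.src = t₂.src → t₁.guard ≠ t₂.guard →
    ∀ (x : Fin m → V) (i : Fin r → V), ¬ (t₁.guard ⊓ t₂.guard).Realize (Sum.elim x i)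
  target_unique : ∀ t₁ ∈ δ, ∀ t₂ ∈ δ, t₁.src = t₂.src → t₁.guard = t₂.guard →
    t₁.update = t₂.update → t₁.tgt = t₂.tgt
  no_deadend : ∀ (l : Loc) (x : Fin m → V), (Inv l).Realize x →
    ∃ t ∈ δ, t.src = l ∧ ∃ i : Fin r → V, t.guard.Realize (Sum.elim x i) ∧
      (Inv t.tgt).Realize (nextAssignment t.update x i)

namespace RPG

variable {ℒ : FirstOrder.Language.{u, v}} {V : Type w} [ℒ.Structure V] {m r : ℕ} {Loc : Type z}
variable (G : RPG ℒ V m r Loc)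

/-- States: pairs of a location and an assignment satisfying the invariant of that location. -/
abbrev State : Type (max w z) := {s : Loc × (Fin m → V) // (G.Inv s.1).Realize s.2}

/-- Environment moves. -/
abbrev Inputs (_ : RPG ℒ V m r Loc) : Type w := Fin r → V

/-- System moves. -/
abbrev Updates : Type u :=
  {u : Fin m → ℒ.Term (Fin m ⊕ Fin r) // ∃ t ∈ G.δ, t.update = u}

/-- The game structure `⟦G⟧`. -/
def sem : GameStructure G.State G.Inputs G.Updates where
  rel s i u s' := ∃ t ∈ G.δ, t.src = s.1.1 ∧ t.update = u.1 ∧ t.tgt = s'.1.1 ∧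
    t.guard.Realize (Sum.elim s.1.2 i) ∧ s'.1.2 = nextAssignment u.1 s.1.2 i
  total := by
    rintro ⟨⟨l, x⟩, hx⟩
    obtain ⟨t, ht, hsrc, i, hg, hinv⟩ := G.no_deadend l x hx
    exact ⟨i, ⟨t.update, t, ht, rfl⟩, ⟨(t.tgt, nextAssignment t.update x i), hinv⟩,
      t, ht, hsrc, rfl, rfl, hg, rfl⟩
  deterministic := by
    rintro s i u s₁ s₂ ⟨t₁, ht₁, hs₁, hu₁, hl₁, hg₁, hx₁⟩ ⟨t₂, ht₂, hs₂, hu₂, hl₂, hg₂, hx₂⟩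
    have hg : t₁.guard = t₂.guard := by
      by_contra hne
      exact G.guards_disjoint t₁ ht₁ t₂ ht₂ (hs₁.trans hs₂.symm) hne s.1.2 i
        (Formula.realize_inf.2 ⟨hg₁, hg₂⟩)
    have hl := G.target_unique t₁ ht₁ t₂ ht₂ (hs₁.trans hs₂.symm) hg (hu₁.trans hu₂.symm)
    exact Subtype.ext (Prod.ext (by rw [← hl₁, ← hl₂, hl]) (by rw [hx₁, hx₂]))

/-- In every state, every input of the environment can be answered by the system. -/
def InputEnabled : Prop := ∀ (s : G.State) (i : G.Inputs), i ∈ G.sem.enabledE s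

/-- The transitions leaving a location. -/
abbrev Outgoing (l : Loc) : Type (max u v z) := {t : Transition ℒ m r Loc // t ∈ G.δ ∧ t.src = l}

instance (l : Loc) : Finite (G.Outgoing l) :=
  (G.finite_δ.subset fun _ h => h.1).to_subtype

/-! ### Symbolic sets of states -/

/-- The symbolic domain `𝒟`. -/
abbrev SymbolicSet (_ : RPG ℒ V m r Loc) : Type (max u v z) := Loc → ℒ.Formula (Fin m)

/-- The set of states `⟦d⟧`. -/
def denote (d : G.SymbolicSet) : Set G.State := {s | (d s.1.1).Realize s.1.2}

/-! ### Controllable predecessors -/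

/-- The shape common to the controllable predecessor formulas over an arbitrary language and set
`α` of free variables besides the inputs: `inv` is the invariant at the location, and `g t`,
`inv' t`, `d' t` are the guard, `Inv(l')[u]` and `d(l')[u]` for a transition `t`. -/
def _root_.cpreFormula {ℒ' : FirstOrder.Language.{u, v}} {α : Type*} {ι : Type*} [Finite ι] {r : ℕ}
    (p : Player) (inv : ℒ'.Formula α) (g inv' d' : ι → ℒ'.Formula (α ⊕ Fin r)) : ℒ'.Formula α :=
  match p with
  | .env => inv ⊓ Formula.iExs (Fin r) (Formula.iInf fun t => (g t ⊓ inv' t).imp (d' t))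
  | .sys => inv ⊓ Formula.iAlls (Fin r) (Formula.iSup fun t => g t ⊓ inv' t ⊓ d' t)

/-- `CPre_{G,p}(d)`. -/
def cpre (p : Player) (d : G.SymbolicSet) : G.SymbolicSet := fun l =>
  cpreFormula p (G.Inv l)
    (fun t : G.Outgoing l => t.1.guard)
    (fun t => (G.Inv t.1.tgt).subst t.1.update)
    (fun t => (d t.1.tgt).subst t.1.update)

end RPG

/-! ### Acceleration lemmas -/

/-- Acceleration lemmas over the program variables. In `step`, the variable `Sum.inl y` stands for
`y` and `Sum.inr y` for the primed variable `y'`. -/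
structure AccelerationLemma (ℒ : FirstOrder.Language.{u, v}) (V : Type w) [ℒ.Structure V] (m : ℕ) where
  base : ℒ.Formula (Fin m)
  step : ℒ.Formula (Fin m ⊕ Fin m)
  conc : ℒ.Formula (Fin m)
  reaches_base : ∀ α : ℕ → Fin m → V, conc.Realize (α 0) →
    (∀ i, step.Realize (Sum.elim (α i) (α (i + 1)))) → ∃ k, base.Realize (α k)
  conc_step : ∀ x : Fin m → V, conc.Realize x → ¬ base.Realize x →
    ∀ x' : Fin m → V, step.Realize (Sum.elim x x') → conc.Realize x'

/-! ### Loop games -/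

namespace RPG

variable {ℒ : FirstOrder.Language.{u, v}} {V : Type w} [ℒ.Structure V] {m r : ℕ} {Loc : Type z}
variable (G : RPG ℒ V m r Loc)

open scoped Classical in
/-- The target of a transition in the loop game at `l`; the fresh location `l_End` is `none`. -/
def redirect (l l' : Loc) : Option Loc := if l' = l then none else some l'

/-- The image in the loop game at `l` of a transition of the game. -/
def loopTransition (l : Loc) (t : Transition ℒ m r Loc) : Transition ℒ m r (Option Loc) :=
  ⟨some t.src, t.guard, t.update, redirect l t.tgt⟩

/-- The transition `(l_End, ⊤, id, l_End)`. -/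
def endTransition : Transition ℒ m r (Option Loc) :=
  ⟨none, ⊤, fun x => Term.var (Sum.inl x), none⟩

/-- `LoopGame(G, l, l_End)`: all transitions with target `l` are redirected to the fresh location
`l_End`, which has the invariant of `l` and an identity self-loop. -/
def loopGame (l : Loc) : RPG ℒ V m r (Option Loc) where
  finite_loc := by
    have := G.finite_loc
    infer_instance
  Inv l' := l'.elim (G.Inv l) G.Inv
  δ := insert endTransition (loopTransition l '' G.δ)
  finite_δ := (G.finite_δ.image _).insert _
  guard_qf := by
    rintro t (rfl | ⟨t, ht, rfl⟩)
    · exact BoundedFormula.IsQF.top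
    · exact G.guard_qf t ht
  guards_cover := by
    rintro (_ | l') x i
    · exact ⟨_, Or.inl rfl, rfl, Formula.realize_top.2 trivial⟩
    · obtain ⟨t, ht, rfl, hg⟩ := G.guards_cover l' x i
      exact ⟨_, Or.inr ⟨t, ht, rfl⟩, rfl, hg⟩
  guards_disjoint := by
    rintro t₁ (rfl | ⟨t₁, ht₁, rfl⟩) t₂ (rfl | ⟨t₂, ht₂, rfl⟩) hs hne
    · exact absurd rfl hne
    · simp [endTransition, loopTransition] at hs
    · simp [endTransition, loopTransition] at hs
    · exact G.guards_disjoint t₁ ht₁ t₂ ht₂ (Option.some.inj hs) hne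
  target_unique := by
    rintro t₁ (rfl | ⟨t₁, ht₁, rfl⟩) t₂ (rfl | ⟨t₂, ht₂, rfl⟩) hs hg hu
    · rfl
    · simp [endTransition, loopTransition] at hs
    · simp [endTransition, loopTransition] at hs
    · exact congrArg (redirect l) (G.target_unique t₁ ht₁ t₂ ht₂ (Option.some.inj hs) hg hu)
  no_deadend := by
    rintro (_ | l') x hx
    · obtain ⟨_, _, _, i, _⟩ := G.no_deadend l x hx
      exact ⟨_, Or.inl rfl, rfl, i, Formula.realize_top.2 trivial, hx⟩
    · obtain ⟨t, ht, rfl, i, hg, hinv⟩ := G.no_deadend l' x hx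
      refine ⟨_, Or.inr ⟨t, ht, rfl⟩, rfl, i, hg, ?_⟩
      by_cases h : t.tgt = l
      · simpa [loopTransition, redirect, h] using hinv
      · simpa [loopTransition, redirect, h] using hinv

end RPG

/-! ### Formulas with uninterpreted lemma symbols

`LemmaSymb` is the set of triples `(b_k, st_k, c_k)`, `k ∈ ℕ`, of uninterpreted predicate symbols.
The type `C` is the set of uninterpreted constants currently in scope. Such constants are free
variables that are never quantified: a formula over the program variables and the constants has its
free variables in `C ⊕ Fin m`. Adding a family `E = {e_x}` of fresh constants, one for each program
variable, means passing from `C` to the disjoint sum `C ⊕ Fin m`. -/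

/-- The uninterpreted predicate symbols; the second index is the arity. -/
inductive LemmaRel (m : ℕ) : ℕ → Type
  | base (k : ℕ) : LemmaRel m m
  | step (k : ℕ) : LemmaRel m (m + m)
  | conc (k : ℕ) : LemmaRel m m

/-- The language `ℒ` together with the lemma symbols. -/
abbrev FirstOrder.Language.withLemmas (ℒ : FirstOrder.Language.{u, v}) (m : ℕ) : FirstOrder.Language.{u, v} :=
  ℒ.sum ⟨fun _ => PEmpty, fun n => ULift (LemmaRel m n)⟩

/-- Formulas without free program variables: the constraints. -/
abbrev Constraint (ℒ : FirstOrder.Language.{u, v}) (m : ℕ) (C : Type) : Type (max u v) :=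
  (ℒ.withLemmas m).Formula C

/-- Formulas whose free variables are program variables. -/
abbrev LFormula (ℒ : FirstOrder.Language.{u, v}) (m : ℕ) (C : Type) : Type (max u v) :=
  (ℒ.withLemmas m).Formula (C ⊕ Fin m)

section LemmaFormulas

variable {ℒ : FirstOrder.Language.{u, v}} {m : ℕ} {C : Type}

/-- An `ℒ`-formula over the program variables, seen as a formula with lemma symbols. -/
def embed (φ : ℒ.Formula (Fin m)) : LFormula ℒ m C :=
  (LHom.sumInl.onFormula φ).relabel Sum.inr

/-- `b_k(X)`. -/
def baseAtom (k : ℕ) : LFormula ℒ m C :=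
  Relations.formula (Sum.inr ⟨LemmaRel.base k⟩ : (ℒ.withLemmas m).Relations m)
    fun x => Term.var (Sum.inr x)

/-- `c_k(X)`. -/
def concAtom (k : ℕ) : LFormula ℒ m C :=
  Relations.formula (Sum.inr ⟨LemmaRel.conc k⟩ : (ℒ.withLemmas m).Relations m)
    fun x => Term.var (Sum.inr x)

/-- `st_k(E, X)`, for the family `E` of fresh constants added to the scope `C`. -/
def stepAtom (k : ℕ) : LFormula ℒ m (C ⊕ Fin m) :=
  Relations.formula (Sum.inr ⟨LemmaRel.step k⟩ : (ℒ.withLemmas m).Relations (m + m))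
    (Fin.append (fun x => Term.var (Sum.inl (Sum.inr x))) (fun x => Term.var (Sum.inr x)))

/-- A formula in scope `C`, seen as a formula in the scope extended by fresh constants. -/
def weaken (φ : LFormula ℒ m C) : LFormula ℒ m (C ⊕ Fin m) :=
  φ.relabel (Sum.elim (fun e => Sum.inl (Sum.inl e)) Sum.inr)

/-- The substitution `[E ↦ X]` on formulas. -/
def replaceE (φ : LFormula ℒ m (C ⊕ Fin m)) : LFormula ℒ m C :=
  φ.relabel (Sum.elim (Sum.elim Sum.inl Sum.inr) Sum.inr)

/-- The substitution `[E ↦ X]` on constraints. -/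
def replaceEConstraint (Ψ : Constraint ℒ m (C ⊕ Fin m)) : LFormula ℒ m C :=
  Ψ.relabel (Sum.elim Sum.inl Sum.inr)

/-- A term over program and input variables, seen as a term in the larger language and scope. -/
def embedTerm {r : ℕ} (t : ℒ.Term (Fin m ⊕ Fin r)) : (ℒ.withLemmas m).Term ((C ⊕ Fin m) ⊕ Fin r) :=
  (LHom.sumInl.onTerm t).relabel (Sum.map Sum.inr id)

/-- An `ℒ`-formula over program and input variables, seen in the larger language and scope. -/
def embedInput {r : ℕ} (φ : ℒ.Formula (Fin m ⊕ Fin r)) :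
    (ℒ.withLemmas m).Formula ((C ⊕ Fin m) ⊕ Fin r) :=
  (LHom.sumInl.onFormula φ).relabel (Sum.map Sum.inr id)

/-- `φ[u]`: the program variables are replaced by their update terms, constants are kept. -/
def substUpdate {r : ℕ} (u : Fin m → ℒ.Term (Fin m ⊕ Fin r)) (φ : LFormula ℒ m C) :
    (ℒ.withLemmas m).Formula ((C ⊕ Fin m) ⊕ Fin r) :=
  φ.subst (Sum.elim (fun e => Term.var (Sum.inl (Sum.inl e))) fun x => embedTerm (u x))

/-! #### Instantiation of the lemma symbols -/

/-- The lemma symbols are predicate symbols, so every term of the larger language is an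
`ℒ`-term. -/
def dropTerm {α : Type*} : (ℒ.withLemmas m).Term α → ℒ.Term α
  | .var x => .var x
  | .func (Sum.inl f) ts => .func f fun i => dropTerm (ts i)

variable {V : Type w} [ℒ.Structure V]

/-- The formula replacing an atom: an atom of `ℒ` is kept, an atom of a lemma symbol becomes the
corresponding component of the lemma, with the arguments substituted for its variables. -/
def instAtom (lam : ℕ → AccelerationLemma ℒ V m) {α : Type*} {n l : ℕ} :
    ℒ.Relations l ⊕ ULift.{v} (LemmaRel m l) → (Fin l → ℒ.Term (α ⊕ Fin n)) →
      ℒ.BoundedFormula α n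
  | Sum.inl R, ts => BoundedFormula.rel R ts
  | Sum.inr ⟨.base k⟩, ts => BoundedFormula.relabel id ((lam k).base.subst ts)
  | Sum.inr ⟨.step k⟩, ts => BoundedFormula.relabel id ((lam k).step.subst
      (Sum.elim (fun x => ts (Fin.castAdd m x)) fun x => ts (Fin.natAdd m x)))
  | Sum.inr ⟨.conc k⟩, ts => BoundedFormula.relabel id ((lam k).conc.subst ts)

/-- `ψ[λ]`. -/
def instantiate (lam : ℕ → AccelerationLemma ℒ V m) {α : Type*} :
    {n : ℕ} → (ℒ.withLemmas m).BoundedFormula α n → ℒ.BoundedFormula α n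
  | _, .falsum => .falsum
  | _, .equal t₁ t₂ => .equal (dropTerm t₁) (dropTerm t₂)
  | _, .rel R ts => instAtom lam R fun i => dropTerm (ts i)
  | _, .imp φ ψ => .imp (instantiate lam φ) (instantiate lam ψ)
  | _, .all φ => .all (instantiate lam φ)

/-- `InstantiateLemmas(Ψ, φ)` may return `α`: either an instantiation `λ` of the lemma symbols by
acceleration lemmas such that `Ψ[λ]` is valid was found and `α = φ[λ]`, or the search was
unsuccessful and `α = ⊥`. The values of `λ` at symbols that are not used are irrelevant. -/
inductive InstantiateLemmas (V : Type w) [ℒ.Structure V]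
    (Ψ : Constraint ℒ m Empty) (φ : LFormula ℒ m Empty) : ℒ.Formula (Fin m) → Prop
  | found (lam : ℕ → AccelerationLemma ℒ V m)
      (valid : Sentence.Realize V (instantiate lam Ψ : ℒ.Sentence)) :
      InstantiateLemmas V Ψ φ
        (Formula.relabel (Sum.elim Empty.elim id) (instantiate lam φ : ℒ.Formula (Empty ⊕ Fin m)))
  | failed : InstantiateLemmas V Ψ φ ⊥

end LemmaFormulas

/-! ### The accelerated attractor computation -/

namespace RPG

variable {ℒ : FirstOrder.Language.{u, v}} {V : Type w} [ℒ.Structure V] {m r : ℕ} {Loc : Type z} {C : Type}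

/-- Symbolic sets of states whose formulas may contain lemma symbols and constants. -/
abbrev LSymbolicSet (_ : RPG ℒ V m r Loc) (C : Type) : Type (max u v z) := Loc → LFormula ℒ m C

/-- `CPre_{G,p}(d)` for formulas with lemma symbols and constants. -/
def cpreL (G : RPG ℒ V m r Loc) (p : Player) (d : G.LSymbolicSet C) : G.LSymbolicSet C := fun l =>
  cpreFormula p (embed (G.Inv l))
    (fun t : G.Outgoing l => embedInput t.1.guard)
    (fun t => substUpdate t.1.update (embed (G.Inv t.1.tgt)))
    (fun t => substUpdate t.1.update (d t.1.tgt))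

open scoped Classical in
/-- `d[l ↦ d(l) ∨ φ]`. -/
def addAt {ℒ' : FirstOrder.Language.{u, v}} {α : Type*} (d : Loc → ℒ'.Formula α) (l : Loc)
    (φ : ℒ'.Formula α) : Loc → ℒ'.Formula α :=
  fun l' => if l' = l then d l ⊔ φ else d l'

/-- `d ∪ {l_End ↦ st_k(E, X)}`. -/
def dLoop (G : RPG ℒ V m r Loc) (l : Loc) (d : G.LSymbolicSet C) (k : ℕ) :
    (G.loopGame l).LSymbolicSet (C ⊕ Fin m)
  | none => stepAtom k
  | some l' => weaken (d l')

/-- `(∀X. Inv(l) ∧ b(X) → d(l)) ∧ (∀X. Inv(l) ∧ ¬d(l) ∧ c(X) → Ψ_Rec[E ↦ X] ∧ a(l)[E ↦ X])`. -/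
def accConstraint (G : RPG ℒ V m r Loc) (l : Loc) (d : G.LSymbolicSet C) (k : ℕ)
    (ΨRec : Constraint ℒ m (C ⊕ Fin m)) (a : (G.loopGame l).LSymbolicSet (C ⊕ Fin m)) :
    Constraint ℒ m C :=
  Formula.iAlls (Fin m) ((embed (G.Inv l) ⊓ baseAtom k).imp (d l)) ⊓
    Formula.iAlls (Fin m) ((embed (G.Inv l) ⊓ (d l).not ⊓ concAtom k).imp
      (replaceEConstraint ΨRec ⊓ replaceE (a (some l))))

/-! The heuristics `Accelerate?` and `Iterate?` are modelled by nondeterminism: the relations below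
contain the terminating runs for every choice of the heuristics.
The argument `U` is the set of (indices of) lemma symbols picked so far, which makes precise what
it means to pick a fresh triple; `U'` is its value upon return. -/

mutual

/-- `AccA G p l d U Ψ φ U'`: the call `AccA(G, p, l, d)` may return `(Ψ, φ)`. -/
inductive AccA : {Loc : Type z} → {C : Type} → (G : RPG ℒ V m r Loc) → Player → Loc →
    G.LSymbolicSet C → Finset ℕ → Constraint ℒ m C → LFormula ℒ m C → Finset ℕ → Prop
  | intro {Loc : Type z} {C : Type} (G : RPG ℒ V m r Loc) (p : Player) (l : Loc)
      (d : G.LSymbolicSet C) (U : Finset ℕ) (k : ℕ) (fresh : k ∉ U)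
      (ΨRec : Constraint ℒ m (C ⊕ Fin m)) (a : (G.loopGame l).LSymbolicSet (C ⊕ Fin m))
      (U' : Finset ℕ)
      (iter : IterA (G.loopGame l) p ⊤ (G.dLoop l d k) (insert k U) ΨRec a U') :
      AccA G p l d U (G.accConstraint l d k ΨRec a) (concAtom k ⊓ embed (G.Inv l)) U'

/-- `IterA G p Ψ d U Ψ' a U'`: the call `IterA(G, p, Ψ, d)` may return `(Ψ', a)`. -/
inductive IterA : {Loc : Type z} → {C : Type} → (G : RPG ℒ V m r Loc) → Player →
    Constraint ℒ m C → G.LSymbolicSet C → Finset ℕ →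
    Constraint ℒ m C → G.LSymbolicSet C → Finset ℕ → Prop
  | finish {Loc : Type z} {C : Type} (G : RPG ℒ V m r Loc) (p : Player) (Ψ : Constraint ℒ m C)
      (d : G.LSymbolicSet C) (U : Finset ℕ) : IterA G p Ψ d U Ψ d U
  | accelerate {Loc : Type z} {C : Type} (G : RPG ℒ V m r Loc) (p : Player)
      (Ψ : Constraint ℒ m C) (d : G.LSymbolicSet C) (U : Finset ℕ) (l : Loc)
      (ΨRec : Constraint ℒ m C) (φ : LFormula ℒ m C) (U₁ : Finset ℕ)
      (Ψ' : Constraint ℒ m C) (a : G.LSymbolicSet C) (U' : Finset ℕ)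
      (acc : AccA G p l d U ΨRec φ U₁)
      (iter : IterA G p (Ψ ⊓ ΨRec) (addAt d l φ) U₁ Ψ' a U') : IterA G p Ψ d U Ψ' a U'
  | step {Loc : Type z} {C : Type} (G : RPG ℒ V m r Loc) (p : Player)
      (Ψ : Constraint ℒ m C) (d : G.LSymbolicSet C) (U : Finset ℕ)
      (Ψ' : Constraint ℒ m C) (a : G.LSymbolicSet C) (U' : Finset ℕ)
      (iter : IterA G p Ψ (fun l => d l ⊔ G.cpreL p d l) U Ψ' a U') : IterA G p Ψ d U Ψ' a U'

end

variable (G : RPG ℒ V m r Loc)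

/-- The optional acceleration in an iteration of the main loop: `a` may be replaced by `a'`. -/
inductive AccelerationStep (p : Player) (a : G.SymbolicSet) : G.SymbolicSet → Prop
  | skip : AccelerationStep p a a
  | accelerate (l : Loc) (U U' : Finset ℕ) (Ψ : Constraint ℒ m Empty) (φ : LFormula ℒ m Empty)
      (ψ : ℒ.Formula (Fin m)) (acc : AccA G p l (fun l' => embed (a l')) U Ψ φ U')
      (inst : InstantiateLemmas V Ψ φ ψ) : AccelerationStep p a (addAt a l ψ)

/-- `AttractorLoop G p a₀ a₁ res`: the main loop, entered with the last two iterates `a₀` and `a₁`,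
may terminate and return `res`. -/
inductive AttractorLoop (p : Player) : G.SymbolicSet → G.SymbolicSet → G.SymbolicSet → Prop
  | fixpoint (a₀ a₁ : G.SymbolicSet) (eq : G.denote a₁ = G.denote a₀) :
      AttractorLoop p a₀ a₁ a₁
  | iterate (a₀ a₁ a₁' res : G.SymbolicSet) (ne : G.denote a₁ ≠ G.denote a₀)
      (acc : G.AccelerationStep p a₁ a₁')
      (next : AttractorLoop p a₁' (fun l => a₁' l ⊔ G.cpre p a₁' l) res) :
      AttractorLoop p a₀ a₁ res

/-- `AttractorAcc(G, p, d)` may terminate and return `a`. -/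
def AttractorAcc (p : Player) (d a : G.SymbolicSet) : Prop :=
  G.AttractorLoop p (fun _ => ⊥) d a

end RPG

end

/-! ### Attractors as least fixed points -/

-- The attractor of `R` is the least set that contains `R` and is closed under `controllable`, and
-- the rest of the argument uses only this. Closure (`controllable_attr_subset`) is composition of
-- strategies; minimality (`attr_subset`) holds because, outside a closed set, the opponent has a
-- positional strategy that never enters it. Hence attractors are monotone and idempotent
-- (`attr_subset_attr`), and enlarging a set within its own attractor does not change that
-- attractor.
--
-- Each pass of the main loop does exactly this. The `CPre` part stays in the attractor because
-- `CPre` denotes `controllable`. When two successive iterates agree, the loop invariant, that the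
-- second contains the controllable predecessors of the first, says that the result is closed, so it
-- is its own attractor.
--
-- What remains is soundness of acceleration. Instantiating the lemma symbols is replaced by
-- interpreting them (`realize_instantiate`). For a fixed interpretation by acceleration lemmas and
-- any values of the constants, mutual induction on `IterA` and `AccA` shows that the accumulated
-- constraint keeps every intermediate set inside the attractor of the initial one (`IterA.sound`).
-- The core is `mem_attr_of_conc`: a state in `conc` from which `d` cannot be enforced would have a
-- `step`-successor of the same kind, and iterating gives an infinite `step`-sequence that avoids
-- `base`, which an acceleration lemma forbids.

namespace GameStructure

variable {S : Type a} {Me : Type b} {Ms : Type c} (G : GameStructure S Me Ms)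

/-- The states from which Player `p` can enforce that the next state is in `X`. -/
def controllable (p : Player) (X : Set S) : Set S :=
  match p with
  | .env => {s | ∃ me ∈ G.enabledE s, ∀ ms s', G.rel s me ms s' → s' ∈ X}
  | .sys => {s | ∀ me, ∃ ms s', G.rel s me ms s' ∧ s' ∈ X}

theorem controllable_mono (p : Player) {X Y : Set S} (h : X ⊆ Y) :
    G.controllable p X ⊆ G.controllable p Y := by
  cases p with
  | env => exact fun s ⟨me, hme, hs⟩ => ⟨me, hme, fun ms s' hr => h (hs ms s' hr)⟩
  | sys => exact fun s hs me => (hs me).imp fun _ => Exists.imp fun _ => And.imp_right (@h _)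

theorem controllable_empty (p : Player) : G.controllable p ∅ = ∅ := by
  refine Set.subset_empty_iff.1 fun s hs => ?_
  cases p with
  | env =>
    obtain ⟨me, ⟨ms, s', h⟩, hs⟩ := hs
    exact hs ms s' h
  | sys =>
    obtain ⟨me, -⟩ := G.total s
    obtain ⟨ms, s', -, hs'⟩ := hs me
    exact absurd hs' (Set.notMem_empty s')

/-- Every move of the environment is enabled in every state. -/
def AllEnabled : Prop := ∀ s me, me ∈ G.enabledE s

instance : Nonempty (G.Strategy .env) := by
  choose me ms s' h using G.total
  exact ⟨⟨fun _ s => me s, fun _ s => ⟨ms s, s' s, h s⟩⟩⟩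

/-- A system strategy must answer every environment move at every history, so totality of the game
alone does not provide one. -/
theorem nonempty_sys_strategy (hG : G.AllEnabled) : Nonempty (G.Strategy .sys) := by
  choose ms h using hG
  exact ⟨⟨fun _ s me => ms s me, fun _ s me => h s me⟩⟩

theorem exists_outcome (s : S) (σe : G.Strategy .env) (σs : G.Strategy .sys) :
    ∃ π, G.IsOutcome s σe σs π := by
  have hnext : ∀ (h : List S) (x : S), ∃ y,
      G.rel x (σe.down.1 h x) (σs.1 h x (σe.down.1 h x)) y :=
    fun h x => σs.2 h x (σe.down.1 h x)
  choose next hnext using hnext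
  -- The next state depends on the whole past, so the recursion carries the history along with the
  -- current state; `hist` identifies that history with the prefix of the play.
  let conf : ℕ → List S × S := fun n =>
    Nat.rec ([], s) (fun _ q => (q.1 ++ [q.2], next q.1 q.2)) n
  have hist : ∀ n, (List.range n).map (fun k => (conf k).2) = (conf n).1 := by
    intro n
    induction n with
    | zero => rfl
    | succ n ih => rw [List.range_succ, List.map_append, ih]; rfl
  refine ⟨fun n => (conf n).2, rfl, fun n => ?_⟩
  simp only [hist n]
  exact hnext (conf n).1 (conf n).2

theorem subset_attr (hG : G.AllEnabled) (p : Player) (R : Set S) : R ⊆ G.Attr p R := by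
  intro s hs
  cases p with
  | env =>
    refine ⟨Classical.arbitrary _, ?_⟩
    rintro π ⟨τ, h0, -⟩
    exact ⟨0, h0 ▸ hs⟩
  | sys =>
    refine ⟨(G.nonempty_sys_strategy hG).some, ?_⟩
    rintro π ⟨τ, h0, -⟩
    exact ⟨0, h0 ▸ hs⟩

/-- The first state of the history `h` followed by `s`. -/
def firstState (h : List S) (s : S) : S := h.headD s

theorem firstState_map_range (π : ℕ → S) (n : ℕ) :
    firstState ((List.range n).map π) (π n) = π 0 := by
  cases n with
  | zero => rfl
  | succ n => simp [firstState, List.range_succ_eq_map]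

theorem map_range_succ (π : ℕ → S) (n : ℕ) :
    (List.range (n + 1)).map π = π 0 :: (List.range n).map (fun k => π (k + 1)) := by
  simp [List.range_succ_eq_map, Function.comp_def]

/-- The tail of a play is a play in which the opponent's strategy remembers the first state. -/
theorem tail_mem_plays_env {s : S} {σ σ' : G.Strategy .env} {π : ℕ → S}
    (h : π ∈ G.Plays .env s σ)
    (hσ : ∀ h x, firstState h x = π 1 → σ.down.1 (s :: h) x = σ'.down.1 h x) :
    (fun n => π (n + 1)) ∈ G.Plays .env (π 1) σ' := by
  obtain ⟨τ, rfl, h⟩ := h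
  refine ⟨⟨fun h x me => τ.1 (π 0 :: h) x me, fun h x me => τ.2 _ x me⟩, rfl, fun n => ?_⟩
  have := h (n + 1)
  simp only [map_range_succ] at this
  -- All histories of the tail start in `π 1`, so the agreement of `σ` and `σ'` on such histories is
  -- enough.
  rw [hσ _ _ (firstState_map_range (fun n => π (n + 1)) n)] at this
  exact this

/-- The tail of a play is a play in which the opponent's strategy remembers the first state. -/
theorem tail_mem_plays_sys {s : S} {σ σ' : G.Strategy .sys} {π : ℕ → S}
    (h : π ∈ G.Plays .sys s σ)
    (hσ : ∀ h x me, firstState h x = π 1 → σ.1 (s :: h) x me = σ'.1 h x me) :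
    (fun n => π (n + 1)) ∈ G.Plays .sys (π 1) σ' := by
  obtain ⟨τ, rfl, h⟩ := h
  refine ⟨⟨fun h x => τ.down.1 (π 0 :: h) x, fun h x => τ.down.2 _ x⟩, rfl, fun n => ?_⟩
  have := h (n + 1)
  simp only [map_range_succ] at this
  rw [hσ _ _ _ (firstState_map_range (fun n => π (n + 1)) n)] at this
  exact this

open scoped Classical in
-- Make the good first move, then follow a winning strategy of the state reached. Once the head of
-- the history is dropped, its first state tells which strategy that is.
theorem controllable_attr_subset (hG : G.AllEnabled) (p : Player) (R : Set S) :
    G.controllable p (G.Attr p R) ⊆ G.Attr p R := by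
  intro s hs
  cases p with
  | env =>
    obtain ⟨me, hme, hs⟩ := hs
    -- One strategy is chosen for every state at once; off the attractor it is a dummy.
    have hwin : ∀ x, ∃ σ : G.Strategy .env, x ∈ G.Attr .env R →
        ∀ π ∈ G.Plays .env x σ, ∃ n, π n ∈ R := by
      intro x
      by_cases hx : x ∈ G.Attr .env R
      · exact hx.imp fun σ hσ _ => hσ
      · exact ⟨Classical.arbitrary _, fun h => absurd h hx⟩
    choose win hwin using hwin
    refine ⟨⟨⟨fun h x => match h with
      -- The value away from `s` never matters for plays from `s`, but a strategy must be enabled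
      -- everywhere.
      | [] => if x = s then me else (win x).down.1 [] x
      | _ :: h => (win (firstState h x)).down.1 h x, ?_⟩⟩, ?_⟩
    · intro h x
      match h with
      | [] =>
        dsimp only
        split_ifs with hx
        · exact hx ▸ hme
        · exact (win x).down.2 [] x
      | _ :: h => exact (win _).down.2 h x
    · intro π hπ
      have h1 : π 1 ∈ G.Attr .env R := by
        obtain ⟨τ, rfl, h⟩ := hπ
        exact hs _ _ (by simpa using h 0)
      obtain ⟨n, hn⟩ := hwin _ h1 _
        (G.tail_mem_plays_env (σ' := win (π 1)) hπ (fun h x hx => by simp only [hx]))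
      exact ⟨n + 1, hn⟩
  | sys =>
    choose ms s' hrel hs' using hs
    have hwin : ∀ x, ∃ σ : G.Strategy .sys, x ∈ G.Attr .sys R →
        ∀ π ∈ G.Plays .sys x σ, ∃ n, π n ∈ R := by
      intro x
      by_cases hx : x ∈ G.Attr .sys R
      · exact hx.imp fun σ hσ _ => hσ
      · exact ⟨(G.nonempty_sys_strategy hG).some, fun h => absurd h hx⟩
    choose win hwin using hwin
    refine ⟨⟨fun h x me => match h with
      | [] => if x = s then ms me else (win x).1 [] x me
      | _ :: h => (win (firstState h x)).1 h x me, ?_⟩, ?_⟩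
    · intro h x me
      match h with
      | [] =>
        dsimp only
        split_ifs with hx
        · exact hx ▸ ⟨_, hrel me⟩
        · exact (win x).2 [] x me
      | _ :: h => exact (win _).2 h x me
    · intro π hπ
      have h1 : π 1 ∈ G.Attr .sys R := by
        obtain ⟨τ, rfl, h⟩ := hπ
        have h := h 0
        simp only [List.range_zero, List.map_nil, if_true] at h
        -- By determinism, the play reaches the successor chosen in the attractor.
        exact G.deterministic _ _ _ _ _ h (hrel _) ▸ hs' _
      obtain ⟨n, hn⟩ := hwin _ h1 _
        (G.tail_mem_plays_sys (σ' := win (π 1)) hπ (fun h x me hx => by simp only [hx]))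
      exact ⟨n + 1, hn⟩

open scoped Classical in
-- At a state outside the closed set `X`, failure of controllability gives the opponent a move after
-- which the play is again outside `X`. Played positionally against any `σ`, these moves yield an
-- outcome that avoids `X`, hence `R`.
theorem attr_subset (hG : G.AllEnabled) {p : Player} {R X : Set S} (hR : R ⊆ X)
    (hX : G.controllable p X ⊆ X) : G.Attr p R ⊆ X := by
  rintro s ⟨σ, hσ⟩
  by_contra hs
  cases p with
  | env =>
    have hms : ∀ x me, ∃ ms ∈ G.enabledS x me, x ∉ X → ∀ s', G.rel x me ms s' → s' ∉ X := by
      intro x me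
      by_cases hx : x ∈ X
      · obtain ⟨ms, h⟩ := hG x me
        exact ⟨ms, h, fun h => absurd hx h⟩
      · have : x ∉ G.controllable .env X := fun h => hx (hX h)
        simp only [controllable, Set.mem_ofPred_eq, not_exists, not_and, not_forall] at this
        obtain ⟨ms, s', h, hs'⟩ := this me (hG x me)
        -- One successor of `ms` outside `X` suffices, since it is the only one.
        exact ⟨ms, ⟨s', h⟩, fun _ t ht => G.deterministic _ _ _ _ _ h ht ▸ hs'⟩
    choose ms hms hout using hms
    let τ : G.Strategy .sys := ⟨fun _ x me => ms x me, fun _ x me => hms x me⟩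
    obtain ⟨π, hπ⟩ := G.exists_outcome s σ τ
    obtain ⟨n, hn⟩ := hσ π ⟨τ, hπ⟩
    have : ∀ n, π n ∉ X := by
      intro n
      induction n with
      | zero => exact hπ.1 ▸ hs
      | succ n ih => exact hout _ _ ih _ (hπ.2 n)
    exact this n (hR hn)
  | sys =>
    have hme : ∀ x, ∃ me ∈ G.enabledE x, x ∉ X → ∀ ms s', G.rel x me ms s' → s' ∉ X := by
      intro x
      by_cases hx : x ∈ X
      · obtain ⟨me, h⟩ := G.total x
        exact ⟨me, h, fun h => absurd hx h⟩
      · have : x ∉ G.controllable .sys X := fun h => hx (hX h)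
        simp only [controllable, Set.mem_ofPred_eq, not_exists, not_and, not_forall] at this
        obtain ⟨me, h⟩ := this
        exact ⟨me, hG x me, fun _ => h⟩
    choose me hme hout using hme
    let τ : G.Strategy .env := ⟨⟨fun _ x => me x, fun _ x => hme x⟩⟩
    obtain ⟨π, hπ⟩ := G.exists_outcome s τ σ
    obtain ⟨n, hn⟩ := hσ π ⟨τ, hπ⟩
    have : ∀ n, π n ∉ X := by
      intro n
      induction n with
      | zero => exact hπ.1 ▸ hs
      | succ n ih => exact hout _ ih _ _ (hπ.2 n)
    exact this n (hR hn)

theorem controllable_subset_attr (hG : G.AllEnabled) (p : Player) (R : Set S) :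
    G.controllable p R ⊆ G.Attr p R :=
  (G.controllable_mono p (G.subset_attr hG p R)).trans (G.controllable_attr_subset hG p R)

/-- Reaching a set of states from all of which `R` can be enforced suffices to enforce `R`. -/
theorem attr_subset_attr (hG : G.AllEnabled) {p : Player} {R R' : Set S}
    (h : R' ⊆ G.Attr p R) : G.Attr p R' ⊆ G.Attr p R :=
  G.attr_subset hG h (G.controllable_attr_subset hG p R)

end GameStructure

/-! ### Truth of formulas with lemma symbols -/

section LemmaSemantics

variable {ℒ : FirstOrder.Language.{u, v}} {V : Type w} [ℒ.Structure V] {m r : ℕ} {C : Type}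

/-- The interpretation of the lemma symbols by a family of acceleration lemmas. -/
@[reducible]
def lemmaStructure (lam : ℕ → AccelerationLemma ℒ V m) :
    FirstOrder.Language.Structure.{u, v, w} ⟨fun _ => PEmpty, fun n => ULift (LemmaRel m n)⟩ V where
  funMap f := f.elim
  RelMap
    | ⟨.base k⟩, xs => (lam k).base.Realize xs
    | ⟨.step k⟩, xs => (lam k).step.Realize
        (Sum.elim (fun x => xs (Fin.castAdd m x)) fun x => xs (Fin.natAdd m x))
    | ⟨.conc k⟩, xs => (lam k).conc.Realize xs

/-- `V` as a structure for the language with lemma symbols. -/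
@[reducible]
def withLemmasStructure (lam : ℕ → AccelerationLemma ℒ V m) : (ℒ.withLemmas m).Structure V :=
  letI := lemmaStructure lam
  sumStructure _ _ V

/-- Truth of a formula with lemma symbols under an interpretation of these symbols. -/
def Holds (lam : ℕ → AccelerationLemma ℒ V m) {α : Type*} (φ : (ℒ.withLemmas m).Formula α)
    (ρ : α → V) : Prop :=
  letI := withLemmasStructure lam
  φ.Realize ρ

variable (lam : ℕ → AccelerationLemma ℒ V m)

theorem realize_dropTerm {α : Type*} (t : (ℒ.withLemmas m).Term α) (ρ : α → V) :
    (dropTerm t).realize ρ = (letI := withLemmasStructure lam; t.realize ρ) := by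
  induction t with
  | var x => simp [dropTerm]
  | func f ts ih =>
    cases f with
    | inl f =>
      simp only [dropTerm, Term.realize, ih]
      rfl
    | inr f => exact f.elim

/-- Atoms may occur under quantifiers, so their arguments range over free and bound variables;
relabelling along `id` restores the split between the two. -/
theorem realize_relabel_id_subst {α β : Type*} {n : ℕ} (φ : ℒ.Formula β)
    (ts : β → ℒ.Term (α ⊕ Fin n)) (ρ : α → V) (xs : Fin n → V) :
    (BoundedFormula.relabel id (φ.subst ts) : ℒ.BoundedFormula α n).Realize ρ xs ↔
      φ.Realize fun y => (ts y).realize (Sum.elim ρ xs) := by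
  refine BoundedFormula.realize_relabel.trans (BoundedFormula.realize_subst.trans ?_)
  exact iff_of_eq (congrArg (BoundedFormula.Realize φ _) (Subsingleton.elim _ _))

/-- Replacing lemma symbols in a formula amounts to interpreting them, so soundness can be proved in
a fixed structure without unfolding `ψ[λ]`. -/
theorem realize_instantiate {α : Type*} {n : ℕ} (φ : (ℒ.withLemmas m).BoundedFormula α n)
    (ρ : α → V) (xs : Fin n → V) :
    (instantiate lam φ).Realize ρ xs ↔
      (letI := withLemmasStructure lam; φ.Realize ρ xs) := by
  induction φ with
  | falsum => rfl
  | equal t₁ t₂ =>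
    simp only [instantiate, BoundedFormula.Realize, realize_dropTerm lam]
  | rel R ts =>
    rcases R with R | R
    · simp only [instantiate, instAtom, BoundedFormula.Realize, realize_dropTerm lam]
      rfl
    · obtain ⟨R⟩ : ULift (LemmaRel m _) := R
      cases R with
      | base k =>
        refine (realize_relabel_id_subst _ _ ρ xs).trans ?_
        simp only [realize_dropTerm lam]
        rfl
      | step k =>
        refine (realize_relabel_id_subst _ _ ρ xs).trans ?_
        change _ ↔ (lam k).step.Realize (Sum.elim _ _)
        refine iff_of_eq (congrArg _ (funext ?_))
        rintro (_ | _) <;> exact realize_dropTerm lam _ _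
      | conc k =>
        refine (realize_relabel_id_subst _ _ ρ xs).trans ?_
        simp only [realize_dropTerm lam]
        rfl
  | imp φ ψ ih₁ ih₂ => simp only [instantiate, BoundedFormula.Realize, ih₁, ih₂]
  | all φ ih => simp only [instantiate, BoundedFormula.Realize, ih]

theorem realize_instantiate_formula {α : Type*} (φ : (ℒ.withLemmas m).Formula α) (ρ : α → V) :
    Formula.Realize (instantiate lam φ : ℒ.Formula α) ρ ↔ Holds lam φ ρ :=
  realize_instantiate lam φ ρ default

-- Truth of the atoms, changes of scope and updates

@[simp]
theorem holds_embed (φ : ℒ.Formula (Fin m)) (ρ : C → V) (x : Fin m → V) :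
    Holds lam (embed φ) (Sum.elim ρ x) ↔ φ.Realize x := by
  let := lemmaStructure lam
  simp [Holds, embed, Formula.realize_relabel, LHom.realize_onFormula]

@[simp]
theorem holds_baseAtom (k : ℕ) (ρ : C → V) (x : Fin m → V) :
    Holds lam (baseAtom k) (Sum.elim ρ x) ↔ (lam k).base.Realize x := by
  let := lemmaStructure lam
  simp only [Holds, baseAtom]
  rfl

@[simp]
theorem holds_concAtom (k : ℕ) (ρ : C → V) (x : Fin m → V) :
    Holds lam (concAtom k) (Sum.elim ρ x) ↔ (lam k).conc.Realize x := by
  let := lemmaStructure lam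
  simp only [Holds, concAtom]
  rfl

@[simp]
theorem holds_stepAtom (k : ℕ) (ρ : C → V) (e x : Fin m → V) :
    Holds lam (stepAtom k) (Sum.elim (Sum.elim ρ e) x) ↔
      (lam k).step.Realize (Sum.elim e x) := by
  let := lemmaStructure lam
  simp only [Holds, stepAtom]
  change (lam k).step.Realize (Sum.elim _ _) ↔ _
  simp only [Fin.append_left, Fin.append_right, Term.relabel, Term.realize_var]
  rfl

@[simp]
theorem holds_weaken (φ : LFormula ℒ m C) (ρ : C → V) (e x : Fin m → V) :
    Holds lam (weaken φ) (Sum.elim (Sum.elim ρ e) x) ↔ Holds lam φ (Sum.elim ρ x) := by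
  simp only [Holds, weaken, Formula.realize_relabel]
  congr! 1
  ext (_ | _) <;> rfl

-- The substitution `[E ↦ X]` is evaluation of the constants at the current assignment: it records
-- the values with which the loop is entered.
@[simp]
theorem holds_replaceE (φ : LFormula ℒ m (C ⊕ Fin m)) (ρ : C → V) (x : Fin m → V) :
    Holds lam (replaceE φ) (Sum.elim ρ x) ↔ Holds lam φ (Sum.elim (Sum.elim ρ x) x) := by
  simp only [Holds, replaceE, Formula.realize_relabel]
  congr! 1
  ext ((_ | _) | _) <;> rfl

@[simp]
theorem holds_replaceEConstraint (Ψ : Constraint ℒ m (C ⊕ Fin m)) (ρ : C → V) (x : Fin m → V) :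
    Holds lam (replaceEConstraint Ψ) (Sum.elim ρ x) ↔ Holds lam Ψ (Sum.elim ρ x) := by
  simp only [Holds, replaceEConstraint, Formula.realize_relabel]
  congr! 1
  ext (_ | _) <;> rfl

@[simp]
theorem holds_embedInput (φ : ℒ.Formula (Fin m ⊕ Fin r)) (ρ : C → V) (x : Fin m → V)
    (i : Fin r → V) :
    Holds lam (embedInput φ) (Sum.elim (Sum.elim ρ x) i) ↔ φ.Realize (Sum.elim x i) := by
  let := lemmaStructure lam
  simp [Holds, embedInput, Formula.realize_relabel, LHom.realize_onFormula, Sum.elim_comp_map]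

@[simp]
theorem holds_substUpdate (u : Fin m → ℒ.Term (Fin m ⊕ Fin r)) (φ : LFormula ℒ m C) (ρ : C → V)
    (x : Fin m → V) (i : Fin r → V) :
    Holds lam (substUpdate u φ) (Sum.elim (Sum.elim ρ x) i) ↔
      Holds lam φ (Sum.elim ρ (nextAssignment u x i)) := by
  let := lemmaStructure lam
  simp only [Holds, substUpdate, Formula.Realize, BoundedFormula.realize_subst]
  congr! 1
  ext (_ | _)
  · rfl
  · simp [embedTerm, nextAssignment, Term.realize_relabel, LHom.realize_onTerm, Sum.elim_comp_map]

end LemmaSemantics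

theorem realize_cpreFormula {ℒ' : FirstOrder.Language.{u, v}} {V : Type w} [ℒ'.Structure V]
    {α : Type*} {ι : Type*} [Finite ι] {r : ℕ} (p : Player) (inv : ℒ'.Formula α)
    (g inv' d' : ι → ℒ'.Formula (α ⊕ Fin r)) (ρ : α → V) :
    (cpreFormula p inv g inv' d').Realize ρ ↔ inv.Realize ρ ∧
      match p with
      | .env => ∃ i : Fin r → V, ∀ t, (g t).Realize (Sum.elim ρ i) →
          (inv' t).Realize (Sum.elim ρ i) → (d' t).Realize (Sum.elim ρ i)
      | .sys => ∀ i : Fin r → V, ∃ t, (g t).Realize (Sum.elim ρ i) ∧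
          (inv' t).Realize (Sum.elim ρ i) ∧ (d' t).Realize (Sum.elim ρ i) := by
  cases p <;> simp [cpreFormula, and_assoc]

/-! ### Correctness of the accelerated attractor computation -/

namespace RPG

variable {ℒ : FirstOrder.Language.{u, v}} {V : Type w} [ℒ.Structure V] {m r : ℕ} {Loc : Type z}
variable (G : RPG ℒ V m r Loc)

/-- `s'` is a successor of `s` under the input `i`, for some update. -/
def Succ (s : G.State) (i : Fin r → V) (s' : G.State) : Prop :=
  ∃ t ∈ G.δ, t.src = s.1.1 ∧ t.tgt = s'.1.1 ∧ t.guard.Realize (Sum.elim s.1.2 i) ∧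
    s'.1.2 = nextAssignment t.update s.1.2 i

variable {G}

theorem succ_iff_exists_rel {s s' : G.State} {i : Fin r → V} :
    G.Succ s i s' ↔ ∃ u, G.sem.rel s i u s' := by
  constructor
  · rintro ⟨t, ht, hs, hl, hg, hx⟩
    exact ⟨⟨t.update, t, ht, rfl⟩, t, ht, hs, rfl, hl, hg, hx⟩
  · rintro ⟨u, t, ht, hs, hu, hl, hg, hx⟩
    exact ⟨t, ht, hs, hl, hg, hu ▸ hx⟩

theorem inputEnabled_iff : G.InputEnabled ↔ ∀ s i, ∃ s', G.Succ s i s' := by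
  refine forall₂_congr fun s i => ?_
  simp only [succ_iff_exists_rel]
  exact exists_comm

/-- A disabled input would satisfy the right-hand side vacuously; input-enabledness excludes this.
-/
theorem mem_controllable_env (hG : G.InputEnabled) {X : Set G.State} {s : G.State} :
    s ∈ G.sem.controllable .env X ↔ ∃ i, ∀ s', G.Succ s i s' → s' ∈ X := by
  simp only [succ_iff_exists_rel]
  constructor
  · rintro ⟨i, -, h⟩
    exact ⟨i, fun s' ⟨u, hu⟩ => h u s' hu⟩
  · rintro ⟨i, h⟩
    exact ⟨i, hG s i, fun u s' hu => h s' ⟨u, hu⟩⟩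

theorem mem_controllable_sys {X : Set G.State} {s : G.State} :
    s ∈ G.sem.controllable .sys X ↔ ∀ i, ∃ s', G.Succ s i s' ∧ s' ∈ X := by
  simp only [succ_iff_exists_rel]
  refine forall_congr' fun i => ?_
  constructor
  · rintro ⟨u, s', h, hs'⟩
    exact ⟨s', ⟨u, h⟩, hs'⟩
  · rintro ⟨s', ⟨u, h⟩, hs'⟩
    exact ⟨u, s', h, hs'⟩

/-- Enforcing the next state in terms of the transitions leaving the current location. -/
theorem mem_controllable_iff (hG : G.InputEnabled) (p : Player) (D : Loc → (Fin m → V) → Prop)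
    (s : G.State) :
    s ∈ G.sem.controllable p {s | D s.1.1 s.1.2} ↔
      match p with
      | .env => ∃ i : Fin r → V, ∀ t : G.Outgoing s.1.1, t.1.guard.Realize (Sum.elim s.1.2 i) →
          (G.Inv t.1.tgt).Realize (nextAssignment t.1.update s.1.2 i) →
          D t.1.tgt (nextAssignment t.1.update s.1.2 i)
      | .sys => ∀ i : Fin r → V, ∃ t : G.Outgoing s.1.1, t.1.guard.Realize (Sum.elim s.1.2 i) ∧
          (G.Inv t.1.tgt).Realize (nextAssignment t.1.update s.1.2 i) ∧
          D t.1.tgt (nextAssignment t.1.update s.1.2 i) := by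
  cases p with
  | env =>
    rw [mem_controllable_env hG]
    refine exists_congr fun i => ⟨fun h t hg hinv => ?_, ?_⟩
    · exact h ⟨(t.1.tgt, nextAssignment t.1.update s.1.2 i), hinv⟩
        ⟨t.1, t.2.1, t.2.2, rfl, hg, rfl⟩
    · rintro h ⟨⟨l', x'⟩, hinv⟩ ⟨t, ht, hs, rfl, hg, rfl⟩
      exact h ⟨t, ht, hs⟩ hg hinv
  | sys =>
    rw [mem_controllable_sys]
    refine forall_congr' fun i => ⟨?_, ?_⟩
    · rintro ⟨⟨⟨l', x'⟩, hinv⟩, ⟨t, ht, hs, rfl, hg, rfl⟩, hD⟩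
      exact ⟨⟨t, ht, hs⟩, hg, hinv, hD⟩
    · rintro ⟨t, hg, hinv, hD⟩
      exact ⟨⟨(t.1.tgt, nextAssignment t.1.update s.1.2 i), hinv⟩,
        ⟨t.1, t.2.1, t.2.2, rfl, hg, rfl⟩, hD⟩

theorem denote_cpre (hG : G.InputEnabled) (p : Player) (d : G.SymbolicSet) :
    G.denote (G.cpre p d) = G.sem.controllable p (G.denote d) := by
  ext s
  refine Iff.trans ?_ (mem_controllable_iff hG p (fun l x => (d l).Realize x) s).symm
  refine (realize_cpreFormula p _ _ _ _ _).trans ?_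
  rw [and_iff_right s.2]
  have hsubst : ∀ (φ : ℒ.Formula (Fin m)) (u : Fin m → ℒ.Term (Fin m ⊕ Fin r)) (i : Fin r → V),
      Formula.Realize (φ.subst u) (Sum.elim s.1.2 i) ↔ φ.Realize (nextAssignment u s.1.2 i) :=
    fun φ u i => BoundedFormula.realize_subst
  cases p <;> simp only [hsubst]

/-! #### Symbolic sets with lemma symbols -/

section Lemmas

variable {C : Type} (lam : ℕ → AccelerationLemma ℒ V m)

/-- The set of states denoted by a symbolic set with lemma symbols, given values of the symbols
and of the constants in scope. -/
def denoteL (G : RPG ℒ V m r Loc) (ρ : C → V) (d : G.LSymbolicSet C) : Set G.State :=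
  {s | Holds lam (d s.1.1) (Sum.elim ρ s.1.2)}

theorem denoteL_cpreL (hG : G.InputEnabled) (p : Player) (ρ : C → V) (d : G.LSymbolicSet C) :
    denoteL lam G ρ (G.cpreL p d) = G.sem.controllable p (denoteL lam G ρ d) := by
  ext s
  refine Iff.trans ?_
    (mem_controllable_iff hG p (fun l x => Holds lam (d l) (Sum.elim ρ x)) s).symm
  let := withLemmasStructure lam
  refine (realize_cpreFormula p _ _ _ _ _).trans ?_
  change Holds lam _ _ ∧ _ ↔ _
  rw [holds_embed, and_iff_right s.2]
  cases p with
  | env =>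
    change (∃ i, ∀ t, Holds lam _ _ → Holds lam _ _ → Holds lam _ _) ↔ _
    simp only [holds_embedInput, holds_substUpdate, holds_embed]
  | sys =>
    change (∀ i, ∃ t, Holds lam _ _ ∧ Holds lam _ _ ∧ Holds lam _ _) ↔ _
    simp only [holds_embedInput, holds_substUpdate, holds_embed]

theorem denoteL_sup (ρ : C → V) (d d' : G.LSymbolicSet C) :
    denoteL lam G ρ (fun l => d l ⊔ d' l) = denoteL lam G ρ d ∪ denoteL lam G ρ d' := by
  ext s
  let := withLemmasStructure lam
  exact Formula.realize_sup

theorem denoteL_addAt_subset {ρ : C → V} {d : G.LSymbolicSet C} {l : Loc} {φ : LFormula ℒ m C}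
    {X : Set G.State} (hd : denoteL lam G ρ d ⊆ X)
    (hφ : ∀ s : G.State, s.1.1 = l → Holds lam φ (Sum.elim ρ s.1.2) → s ∈ X) :
    denoteL lam G ρ (addAt d l φ) ⊆ X := by
  intro s hs
  by_cases hl : s.1.1 = l
  · simp only [denoteL, addAt, Set.mem_ofPred_eq, if_pos hl] at hs
    let := withLemmasStructure lam
    rcases Formula.realize_sup.1 hs with h | h
    · exact hd (show Holds lam _ _ from hl ▸ h)
    · exact hφ s hl h
  · simp only [denoteL, addAt, Set.mem_ofPred_eq, if_neg hl] at hs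
    exact hd hs

theorem holds_accConstraint {l : Loc} {d : G.LSymbolicSet C} {k : ℕ}
    {ΨRec : Constraint ℒ m (C ⊕ Fin m)} {a : (G.loopGame l).LSymbolicSet (C ⊕ Fin m)}
    {ρ : C → V} :
    Holds lam (G.accConstraint l d k ΨRec a) ρ ↔
      (∀ x, (G.Inv l).Realize x → (lam k).base.Realize x → Holds lam (d l) (Sum.elim ρ x)) ∧
      ∀ x, (G.Inv l).Realize x → ¬ Holds lam (d l) (Sum.elim ρ x) → (lam k).conc.Realize x →
        Holds lam ΨRec (Sum.elim ρ x) ∧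
          Holds lam (a (some l)) (Sum.elim (Sum.elim ρ x) x) := by
  let := withLemmasStructure lam
  refine Iff.trans (b := (∀ x, Holds lam (embed (G.Inv l)) (Sum.elim ρ x) ∧
      Holds lam (baseAtom k) (Sum.elim ρ x) → Holds lam (d l) (Sum.elim ρ x)) ∧
    ∀ x, (Holds lam (embed (G.Inv l)) (Sum.elim ρ x) ∧ ¬ Holds lam (d l) (Sum.elim ρ x)) ∧
      Holds lam (concAtom k) (Sum.elim ρ x) → Holds lam (replaceEConstraint ΨRec) (Sum.elim ρ x) ∧
        Holds lam (replaceE (a (some l))) (Sum.elim ρ x)) ?_ ?_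
  · simp only [Holds, accConstraint, Formula.realize_inf, Formula.realize_iAlls,
      Formula.realize_imp, Formula.realize_not]
  · simp only [holds_embed, holds_baseAtom, holds_concAtom, holds_replaceE,
      holds_replaceEConstraint, and_imp]

/-! #### Loop games -/

/-- The state of `G` that a state of the loop game at `l` stands for. -/
def unloop {l : Loc} (s : (G.loopGame l).State) : G.State :=
  ⟨(s.1.1.getD l, s.1.2), by
    obtain ⟨⟨_ | l', x⟩, h⟩ := s <;> exact h⟩

theorem getD_redirect (l l' : Loc) : (redirect l l').getD l = l' := by
  unfold redirect
  split_ifs with h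
  · exact h.symm
  · rfl

/-- Away from `l_End`, `unloop` is a bisimulation; this is one half and `exists_succ_of_succ_unloop`
is the other. -/
theorem succ_unloop {l : Loc} {s s' : (G.loopGame l).State} {i : Fin r → V}
    (hs : s.1.1 ≠ none) (h : (G.loopGame l).Succ s i s') : G.Succ (unloop s) i (unloop s') := by
  obtain ⟨t, rfl | ⟨t, ht, rfl⟩, hsrc, htgt, hg, hx⟩ := h
  · exact absurd hsrc.symm hs
  · refine ⟨t, ht, ?_, ?_, hg, hx⟩
    · simp [unloop, ← hsrc, loopTransition]
    · simp [unloop, ← htgt, loopTransition, getD_redirect]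

theorem exists_succ_of_succ_unloop {l : Loc} {s : (G.loopGame l).State} {s' : G.State}
    {i : Fin r → V} (hs : s.1.1 ≠ none) (h : G.Succ (unloop s) i s') :
    ∃ s'', (G.loopGame l).Succ s i s'' ∧ unloop s'' = s' := by
  obtain ⟨t, ht, hsrc, htgt, hg, hx⟩ := h
  -- If the target is `l`, it is redirected to `l_End`, which carries the invariant of `l`.
  have hinv : ((G.loopGame l).Inv (redirect l t.tgt)).Realize s'.1.2 := by
    have := s'.2
    rw [← htgt] at this
    unfold redirect
    split_ifs with h
    · exact h ▸ this
    · exact this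
  refine ⟨⟨(redirect l t.tgt, s'.1.2), hinv⟩, ⟨_, Or.inr ⟨t, ht, rfl⟩, ?_, rfl, hg, hx⟩,
    Subtype.ext (Prod.ext ((getD_redirect l t.tgt).trans htgt) rfl)⟩
  obtain ⟨⟨_ | l', x⟩, h⟩ := s
  · exact absurd rfl hs
  · exact congrArg some hsrc

theorem succ_end {l : Loc} {s s' : (G.loopGame l).State} {i : Fin r → V} (hs : s.1.1 = none) :
    (G.loopGame l).Succ s i s' ↔ s' = s := by
  constructor
  · rintro ⟨t, rfl | ⟨t, ht, rfl⟩, hsrc, htgt, hg, hx⟩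
    · exact Subtype.ext (Prod.ext (htgt.symm.trans hs.symm) (hx.trans (funext fun _ => rfl)))
    · rw [hs] at hsrc
      exact absurd hsrc (Option.some_ne_none _)
  · rintro rfl
    exact ⟨_, Or.inl rfl, hs.symm, hs.symm, Formula.realize_top.2 trivial, funext fun _ => rfl⟩

theorem loopGame_inputEnabled (hG : G.InputEnabled) (l : Loc) : (G.loopGame l).InputEnabled := by
  rw [inputEnabled_iff] at hG ⊢
  intro s i
  by_cases hs : s.1.1 = none
  · exact ⟨s, (succ_end hs).2 rfl⟩
  · obtain ⟨s', h⟩ := hG (unloop s) i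
    obtain ⟨s'', h, -⟩ := exists_succ_of_succ_unloop hs h
    exact ⟨s'', h⟩

/-- Away from `l_End` the bisimulation transfers closure of `X`. At `l_End` the only successor of a
state is itself, so forcing the next state into the preimage means being there already. -/
theorem controllable_preimage_unloop_subset (hG : G.InputEnabled) {p : Player} {l : Loc}
    {X : Set G.State} (hX : G.sem.controllable p X ⊆ X) :
    (G.loopGame l).sem.controllable p (unloop ⁻¹' X) ⊆ unloop ⁻¹' X := by
  have hL := loopGame_inputEnabled hG l
  intro s hs
  cases p with
  | env =>
    obtain ⟨i, hi⟩ := (mem_controllable_env hL).1 hs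
    by_cases hn : s.1.1 = none
    · exact hi s ((succ_end hn).2 rfl)
    · refine hX ((mem_controllable_env hG).2 ⟨i, fun s' hs' => ?_⟩)
      obtain ⟨s'', h, rfl⟩ := exists_succ_of_succ_unloop hn hs'
      exact hi s'' h
  | sys =>
    rw [mem_controllable_sys] at hs
    by_cases hn : s.1.1 = none
    · obtain ⟨i, -⟩ := (G.loopGame l).sem.total s
      obtain ⟨s', h, hs'⟩ := hs i
      rwa [(succ_end hn).1 h] at hs'
    · refine hX (mem_controllable_sys.2 fun i => ?_)
      obtain ⟨s', h, hs'⟩ := hs i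
      exact ⟨unloop s', succ_unloop hn h, hs'⟩

/-- Enforcing a set in the loop game enforces its image in the game, provided that the player can
go on from the states in which the loop is closed. -/
theorem attr_loopGame_subset (hG : G.InputEnabled) {p : Player} {l : Loc}
    {R : Set (G.loopGame l).State} {T : Set G.State} (h : R ⊆ unloop ⁻¹' G.sem.Attr p T) :
    (G.loopGame l).sem.Attr p R ⊆ unloop ⁻¹' G.sem.Attr p T :=
  (G.loopGame l).sem.attr_subset (loopGame_inputEnabled hG l) h
    (controllable_preimage_unloop_subset hG (G.sem.controllable_attr_subset hG p T))

/-! #### Acceleration -/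

/-- If from each state at `l` in `conc ∧ ¬ d` the player can enforce in the loop game to reach `d`
or to return to `l` with a step of the acceleration lemma, then `d` can be enforced from `conc`. -/
theorem mem_attr_of_conc (hG : G.InputEnabled) {p : Player} {l : Loc} {d : G.LSymbolicSet C}
    {k : ℕ} {ρ : C → V}
    (hbase : ∀ x, (G.Inv l).Realize x → (lam k).base.Realize x → Holds lam (d l) (Sum.elim ρ x))
    (hloop : ∀ x (hx : (G.Inv l).Realize x), ¬ Holds lam (d l) (Sum.elim ρ x) →
      (lam k).conc.Realize x → (⟨(some l, x), hx⟩ : (G.loopGame l).State) ∈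
        (G.loopGame l).sem.Attr p (denoteL lam (G.loopGame l) (Sum.elim ρ x) (G.dLoop l d k)))
    (x : Fin m → V) (hx : (G.Inv l).Realize x) (hc : (lam k).conc.Realize x) :
    (⟨(l, x), hx⟩ : G.State) ∈ G.sem.Attr p (denoteL lam G ρ d) := by
  by_contra hout
  -- Counterexamples: assignments in `conc` at `l` from which `d` cannot be enforced.
  let Bad := {x : Fin m → V // (lam k).conc.Realize x ∧ ∃ hx : (G.Inv l).Realize x,
    (⟨(l, x), hx⟩ : G.State) ∉ G.sem.Attr p (denoteL lam G ρ d)}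
  have hnd : ∀ y : Bad, ¬ Holds lam (d l) (Sum.elim ρ y.1) := fun y h =>
    y.2.2.2 (G.sem.subset_attr hG p _ h)
  have hnext : ∀ y : Bad, ∃ y' : Bad, (lam k).step.Realize (Sum.elim y.1 y'.1) := by
    rintro y
    obtain ⟨hyc, hyi, hyo⟩ := y.2
    -- Without a bad `step`-successor, every goal state of the loop game projects into the
    -- attractor: at `l_End` it satisfies `step`, hence `conc`, and is not bad; elsewhere it
    -- satisfies `d`.
    by_contra! hno
    refine hyo (attr_loopGame_subset hG ?_ (hloop y.1 hyi (hnd y) hyc))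
    rintro ⟨⟨_ | l', x'⟩, hx'⟩ hs
    · have hst : (lam k).step.Realize (Sum.elim y.1 x') := (holds_stepAtom lam k ρ y.1 x').1 hs
      by_contra hx'o
      exact hno ⟨x', (lam k).conc_step y.1 hyc (fun hb => hnd y (hbase _ hyi hb)) x' hst,
        hx', hx'o⟩ hst
    · exact G.sem.subset_attr hG p _ ((holds_weaken lam (d l') ρ y.1 x').1 hs)
  choose next hnext using hnext
  -- This `step`-sequence starts in `conc`, so it meets `base`; there `d` holds, although no bad
  -- state satisfies `d`.
  let β : ℕ → Bad := fun n => Nat.rec ⟨x, hc, hx, hout⟩ (fun _ y => next y) n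
  obtain ⟨n, hn⟩ := (lam k).reaches_base (fun n => (β n).1) hc fun n => hnext (β n)
  exact hnd (β n) (hbase _ (β n).2.2.1 hn)

/-- Soundness of the recursive call is needed for all values of the constants, because `E` is
evaluated at each assignment `x` from which the loop is entered. -/
theorem AccA.sound_of_iter {l : Loc} {p : Player} {d : G.LSymbolicSet C} {k : ℕ}
    {ΨRec : Constraint ℒ m (C ⊕ Fin m)} {a : (G.loopGame l).LSymbolicSet (C ⊕ Fin m)}
    (hG : G.InputEnabled)
    (iter : ∀ ρ : C ⊕ Fin m → V, Holds lam ΨRec ρ → denoteL lam (G.loopGame l) ρ a ⊆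
      (G.loopGame l).sem.Attr p (denoteL lam (G.loopGame l) ρ (G.dLoop l d k)))
    (ρ : C → V) (hΨ : Holds lam (G.accConstraint l d k ΨRec a) ρ)
    (s : G.State) (hs : s.1.1 = l)
    (hφ : Holds lam (concAtom k ⊓ embed (G.Inv l)) (Sum.elim ρ s.1.2)) :
    s ∈ G.sem.Attr p (denoteL lam G ρ d) := by
  obtain ⟨hbase, hconc⟩ := (holds_accConstraint lam).1 hΨ
  obtain ⟨⟨l', x⟩, hx⟩ := s
  obtain rfl : l' = l := hs
  refine mem_attr_of_conc lam hG hbase (fun x hx hd hc => ?_) x hx ?_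
  · obtain ⟨hΨRec, ha⟩ := hconc x hx hd hc
    exact iter _ hΨRec ha
  · let := withLemmasStructure lam
    exact (holds_concAtom lam k ρ x).1 (Formula.realize_inf.1 hφ).1

/-- Constraints are only ever conjoined, so the final one implies each earlier one; carrying `Holds
lam Ψ ρ` in the conclusion makes the constraint of a nested acceleration available. Each update
stays in the attractor of the set it extends. -/
theorem IterA.sound {p : Player} {d a : G.LSymbolicSet C} {U U' : Finset ℕ}
    {Ψ Ψ' : Constraint ℒ m C} (h : IterA G p Ψ d U Ψ' a U') (hG : G.InputEnabled) (ρ : C → V)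
    (hΨ : Holds lam Ψ' ρ) :
    Holds lam Ψ ρ ∧ denoteL lam G ρ a ⊆ G.sem.Attr p (denoteL lam G ρ d) := by
  revert hG ρ
  -- Recursive calls change the game, its locations and the scope of constants, so both motives
  -- quantify over the valuation and assume input-enabledness anew.
  refine IterA.rec
    (motive_1 := fun {_ C} G p l d _ Ψ φ _ _ => G.InputEnabled → ∀ ρ : C → V, Holds lam Ψ ρ →
      ∀ s : G.State, s.1.1 = l → Holds lam φ (Sum.elim ρ s.1.2) →
        s ∈ G.sem.Attr p (denoteL lam G ρ d))
    (motive_2 := fun {_ C} G p Ψ d _ Ψ' a _ _ => G.InputEnabled → ∀ ρ : C → V, Holds lam Ψ' ρ →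
      Holds lam Ψ ρ ∧ denoteL lam G ρ a ⊆ G.sem.Attr p (denoteL lam G ρ d))
    ?_ ?_ ?_ ?_ h
  · intro _ _ G p l d U k _ ΨRec a U' _ ih hG
    exact AccA.sound_of_iter lam hG fun ρ hρ => (ih (loopGame_inputEnabled hG l) ρ hρ).2
  · intro _ _ G p Ψ d U hG ρ hΨ
    exact ⟨hΨ, G.sem.subset_attr hG p _⟩
  · intro _ _ G p Ψ d U l ΨRec φ U₁ Ψ' a U' _ _ ihAcc ih hG ρ hΨ
    obtain ⟨hΨ, ha⟩ := ih hG ρ hΨ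
    let := withLemmasStructure lam
    obtain ⟨hΨ, hΨRec⟩ := Formula.realize_inf.1 hΨ
    refine ⟨hΨ, ha.trans (G.sem.attr_subset_attr hG ?_)⟩
    exact denoteL_addAt_subset lam (G.sem.subset_attr hG p _) (ihAcc hG ρ hΨRec)
  · intro _ _ G p Ψ d U Ψ' a U' _ ih hG ρ hΨ
    obtain ⟨hΨ, ha⟩ := ih hG ρ hΨ
    refine ⟨hΨ, ha.trans (G.sem.attr_subset_attr hG ?_)⟩
    rw [denoteL_sup, denoteL_cpreL lam hG]
    exact Set.union_subset (G.sem.subset_attr hG p _) (G.sem.controllable_subset_attr hG p _)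

theorem AccA.sound {p : Player} {l : Loc} {d : G.LSymbolicSet C} {U U' : Finset ℕ}
    {Ψ : Constraint ℒ m C} {φ : LFormula ℒ m C} (h : AccA G p l d U Ψ φ U')
    (hG : G.InputEnabled) (ρ : C → V) (hΨ : Holds lam Ψ ρ) (s : G.State) (hs : s.1.1 = l)
    (hφ : Holds lam φ (Sum.elim ρ s.1.2)) : s ∈ G.sem.Attr p (denoteL lam G ρ d) := by
  cases h with
  | intro _ _ _ _ _ k _ ΨRec a _ iter =>
    exact AccA.sound_of_iter lam hG
      (fun ρ hρ => (IterA.sound lam iter (loopGame_inputEnabled hG l) ρ hρ).2) ρ hΨ s hs hφ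

end Lemmas

end RPG

-- Correctness of the main loop

namespace RPG

variable {ℒ : FirstOrder.Language.{u, v}} {V : Type w} [ℒ.Structure V] {m r : ℕ} {Loc : Type z}
variable {G : RPG ℒ V m r Loc}

theorem denote_sup (d d' : G.SymbolicSet) :
    G.denote (fun l => d l ⊔ d' l) = G.denote d ∪ G.denote d' := by
  ext s
  exact Formula.realize_sup

theorem denoteL_embed (lam : ℕ → AccelerationLemma ℒ V m) {C : Type} (ρ : C → V)
    (d : G.SymbolicSet) : denoteL lam G ρ (fun l => embed (d l)) = G.denote d := by
  ext s
  exact holds_embed lam _ _ _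

theorem mem_denote_addAt {a : G.SymbolicSet} {l : Loc} {ψ : ℒ.Formula (Fin m)} {s : G.State} :
    s ∈ G.denote (addAt a l ψ) ↔ s ∈ G.denote a ∨ s.1.1 = l ∧ ψ.Realize s.1.2 := by
  by_cases hl : s.1.1 = l
  · simp [denote, addAt, hl]
  · simp [denote, addAt, hl]

/-- Validity of `Ψ[λ]` is truth of `Ψ` under the interpretation `λ`, so `AccA.sound` applies to a
successful search; a failed one adds only `⊥`. -/
theorem AccelerationStep.subset_and_subset_attr (hG : G.InputEnabled) {p : Player}
    {a a' : G.SymbolicSet} (h : G.AccelerationStep p a a') :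
    G.denote a ⊆ G.denote a' ∧ G.denote a' ⊆ G.sem.Attr p (G.denote a) := by
  cases h with
  | skip => exact ⟨subset_rfl, G.sem.subset_attr hG p _⟩
  | accelerate l U U' Ψ φ ψ acc inst =>
    refine ⟨fun s hs => mem_denote_addAt.2 (Or.inl hs), fun s hs => ?_⟩
    rcases mem_denote_addAt.1 hs with hs | ⟨hl, hψ⟩
    · exact G.sem.subset_attr hG p _ hs
    · cases inst with
      | found lam valid =>
        rw [Formula.realize_relabel, realize_instantiate_formula] at hψ
        have hΨ : Holds lam Ψ (Empty.elim : Empty → V) := by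
          rw [← realize_instantiate_formula, Subsingleton.elim (Empty.elim : Empty → V) default]
          exact valid
        have := AccA.sound lam acc hG Empty.elim hΨ s hl (by
          convert hψ using 1
          ext (e | _)
          · exact e.elim
          · rfl)
        rwa [denoteL_embed] at this
      | failed => exact absurd hψ (by simp)

/-- The main loop returns a symbolic set that denotes the attractor of the current iterate, if it
is entered with iterates of which the second contains the controllable predecessors of the
first. -/
theorem AttractorLoop.denote_eq (hG : G.InputEnabled) {p : Player} {a₀ a₁ res : G.SymbolicSet}
    (h : G.AttractorLoop p a₀ a₁ res)
    (h₀ : G.sem.controllable p (G.denote a₀) ⊆ G.denote a₁) :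
    G.denote res = G.sem.Attr p (G.denote a₁) := by
  induction h with
  | fixpoint a₀ a₁ eq =>
    exact (G.sem.subset_attr hG p _).antisymm
      -- Equality of the iterates turns `h₀` into closure of `a₁` under `controllable`.
      (G.sem.attr_subset hG subset_rfl (eq ▸ h₀))
  | iterate a₀ a₁ a₁' res ne acc next ih =>
    obtain ⟨hle, hattr⟩ := acc.subset_and_subset_attr hG
    rw [denote_sup, denote_cpre hG] at ih
    rw [ih Set.subset_union_right]
    -- The next iterate lies between `a₁` and its attractor, so the two attractors coincide.
    refine (G.sem.attr_subset_attr hG ?_).antisymm (G.sem.attr_subset_attr hG ?_)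
    · exact Set.union_subset hattr
        ((G.sem.controllable_mono p hattr).trans (G.sem.controllable_attr_subset hG p _))
    · exact (hle.trans Set.subset_union_left).trans (G.sem.subset_attr hG p _)

end RPG

theorem mainTheorem1 {ℒ : FirstOrder.Language.{u, v}} {V : Type w} [ℒ.Structure V] {m r : ℕ}
    {Loc : Type z} (G : RPG ℒ V m r Loc) (hG : G.InputEnabled) (p : Player)
    (d a : G.SymbolicSet) (h : G.AttractorAcc p d a) :
    G.denote a = G.sem.Attr p (G.denote d) := by
  refine RPG.AttractorLoop.denote_eq hG h ?_
  -- The loop is entered with `⊥` as previous iterate; nothing can be forced into the empty set, so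
  -- the invariant holds.
  have hbot : G.denote (fun _ => ⊥) = ∅ :=
    Set.subset_empty_iff.1 fun s hs => Formula.realize_bot.1 hs
  rw [hbot, G.sem.controllable_empty]
  exact Set.empty_subset _
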